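/- Let $p$ be a prime, let $F$ be a finite field of characteristic $p$ and order $q$, and let $\psi\colon F\to\mathbb{C}$, $\psi(x)=e^{2\pi i\,\mathrm{Tr}(x)/p}$, be its canonical additive character, where $\mathrm{Tr}\colon F\to\mathbb{F}_p$ is the absolute trace. For a positive integer $d$ with $\gcd(d,q-1)=1$ and $a\in F$ put $$W_{F,d}(a)=\sum_{x\in F}\psi(x^d-ax)\in\mathbb{Q}(e^{2\pi i/p}),\qquad V_{F,d}=\min_{a\in F}\mathrm{val}_p\bigl(W_{F,d}(a)\bigr),$$ where $\mathrm{val}_p$ is the extension of the $p$-adic valuation from $\mathbb{Q}$ to $\mathbb{Q}(e^{2\pi i/p})$, so that $\mathrm{val}_p(p)=1$, $\mathrm{val}_p(1-e^{2\pi i/p})=1/(p-1)$ and $\mathrm{val}_p(0)=\infty$. For a finite field $K$ of characteristic $p$, say that $d$ is degenerate over $K$ if $d$ is congruent to a power of $p$ modulo $|K|-1$, and nondegenerate over $K$ otherwise. Theorem. Suppose that $[F:\mathbb{F}_p]=2^s$ for some integer $s\ge 1$. Let $d$ be a positive integer with $\gcd(d,q-1)=1$ such that $d$ is nondegenerate over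 $F$ but degenerate over $\mathbb{F}_p$. Then $V_{F,d}\le\frac12[F:\mathbb{F}_p]$. Moreover, if $d$ is degenerate over the subfield of $F$ of order $\sqrt q$, then $V_{F,d}=\frac12[F:\mathbb{F}_p]$. -/

import Mathlib

namespace WeilSum

open IntermediateField IsDedekindDomain

section Valuation

variable (p : ℕ) [Fact p.Prime]

/-- The root of unity `e^{2πi/p}` in `ℂ`. -/
noncomputable def zeta : ℂ := Complex.exp (2 * Real.pi * Complex.I / p)

theorem zeta_isPrimitiveRoot : IsPrimitiveRoot (zeta p) p :=
  Complex.isPrimitiveRoot_exp p (Fact.out : p.Prime).ne_zero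

/-- The subfield `ℚ(e^{2πi/p})` of `ℂ`. -/
abbrev CycField : Type := ℚ⟮zeta p⟯

instance : IsCyclotomicExtension {p} ℚ (CycField p) := by
  have hz := zeta_isPrimitiveRoot p
  have : NeZero p := ⟨(Fact.out : p.Prime).ne_zero⟩
  have hi : IsIntegral ℚ (zeta p) := hz.isIntegral (Fact.out : p.Prime).pos |>.tower_top
  change IsCyclotomicExtension {p} ℚ (IntermediateField.adjoin ℚ {zeta p}).toSubalgebra
  rw [IntermediateField.adjoin_simple_toSubalgebra_of_isAlgebraic hi.isAlgebraic]
  exact hz.adjoin_isCyclotomicExtension ℚ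

instance : NumberField (CycField p) :=
  IsCyclotomicExtension.numberField {p} ℚ (CycField p)

theorem gen_isPrimitiveRoot : IsPrimitiveRoot (AdjoinSimple.gen ℚ (zeta p)) p :=
  IsPrimitiveRoot.of_map_of_injective (f := algebraMap (CycField p) ℂ)
    (by simpa using zeta_isPrimitiveRoot p) (algebraMap (CycField p) ℂ).injective

/-- The prime ideal `(e^{2πi/p} - 1)` of the ring of integers of `ℚ(e^{2πi/p})`; it is the only
prime above `p`. -/
noncomputable def primeAbove : HeightOneSpectrum (NumberField.RingOfIntegers (CycField p)) where
  asIdeal := Ideal.span {(gen_isPrimitiveRoot p).toInteger - 1}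
  isPrime := (Ideal.span_singleton_prime (gen_isPrimitiveRoot p).zeta_sub_one_prime'.ne_zero).2
    (gen_isPrimitiveRoot p).zeta_sub_one_prime'
  ne_bot := by
    rw [Ne, Ideal.span_singleton_eq_bot]
    exact (gen_isPrimitiveRoot p).zeta_sub_one_prime'.ne_zero

open scoped Classical in
/-- The `p`-adic valuation on `ℚ(e^{2πi/p})`, written additively, with `valP p 0 = ⊤`: it is the
exponent of the prime `(1 - e^{2πi/p})`, normalized so that `1 - e^{2πi/p}` has valuation
`1 / (p - 1)` (equivalently, so that `p` has valuation `1`). -/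
noncomputable def valP (x : CycField p) : WithTop ℚ :=
  if x = 0 then ⊤
  else (((-WithZero.log ((primeAbove p).valuation (CycField p) x) : ℤ) : ℚ) / ((p : ℚ) - 1) : ℚ)

end Valuation

section Sums

variable (p : ℕ) [Fact p.Prime] (F : Type*) [Field F] [Algebra (ZMod p) F]

/-- The canonical additive character `x ↦ e^{2πi Tr(x) / p}` of `F`, with `Tr` the absolute
trace. -/
noncomputable def canonicalChar (x : F) : ℂ :=
  Complex.exp (2 * Real.pi * Complex.I * (Algebra.trace (ZMod p) F x).val / p)

variable [Fintype F]

/-- The Weil sum `W_{F,d}(a) = ∑_{x ∈ F} ψ(x^d - a x)`. -/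
noncomputable def weilSum (d : ℕ) (a : F) : ℂ :=
  ∑ x : F, canonicalChar p F (x ^ d - a * x)

theorem weilSum_mem (d : ℕ) (a : F) : weilSum p F d a ∈ ℚ⟮zeta p⟯ := by
  refine sum_mem fun x _ => ?_
  have h : canonicalChar p F (x ^ d - a * x) =
      zeta p ^ (Algebra.trace (ZMod p) F (x ^ d - a * x)).val := by
    rw [canonicalChar, zeta, ← Complex.exp_nat_mul]
    congr 1
    ring
  rw [h]
  exact pow_mem (mem_adjoin_simple_self ℚ (zeta p)) _

/-- `V_{F,d}`, the minimum of the `p`-adic valuations of the `W_{F,d}(a)` for `a ∈ F`. -/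
noncomputable def minVal (d : ℕ) : WithTop ℚ :=
  Finset.univ.inf' Finset.univ_nonempty fun a : F => valP p ⟨weilSum p F d a, weilSum_mem p F d a⟩

end Sums

/-- The exponent `d` is degenerate over the finite field `K` of characteristic `p` if it is
congruent to a power of `p` modulo `|K| - 1`. -/
def IsDegenerate (p : ℕ) (K : Type*) (d : ℕ) : Prop :=
  ∃ k : ℕ, d ≡ p ^ k [MOD Nat.card K - 1]

end WeilSum

/-!
The proof needs no Gauss sums. Two facts carry it.

If `d` is degenerate over the subfield `K` of `F` of order `r = √q`, averaging over scalings by `K`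
gives `(r - 1) W(a) = r (M - r)` for a natural number `M`, with `M = 1` or `r ≤ M`
(`exists_count_of_isDegenerate_subfield`). So `r` divides `W(a)` at `p`, that is, `V ≥ [F : 𝔽_p] / 2`.
If `V` were larger, then `p` would divide each `M`, so `M ≥ r` and `W(a) ≥ 0` for all `a`. Since
`W(a) ≤ q`, `∑ W(a) = q` and `∑ W(a)² = q²`, some `W(a)` would be `q`
(`exists_weilSum_eq_card`), so `Tr(x ^ d) = Tr(a x)` for all `x`, which makes `x ↦ x ^ d` a field
automorphism and `d` degenerate over `F` (`isDegenerate_of_weilSum_eq_card`).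

For a quadratic extension `F / L`, `V_{F,d} ≤ 2 V_{L,d}` (`minVal_le_two_mul`). Indeed the
multiplicative convolution square of `W_L` at `b ≠ 0` is the sum of `W_F(a)` over the `a` of norm `b`
(`sum_weilSum_mul_eq_sum_norm_fiber`); this is the Hasse-Davenport relation written on functions, and
it comes from counting pairs in `L × L` and elements of `F` with given trace and norm. A convolution
square cannot be divisible by more than the square of what divides the function, because the group
algebra of `Lˣ` over a field of characteristic `p` is reduced (`eq_zero_of_convolution_eq_zero`).

Along the tower of quadratic extensions from `𝔽_p` to `F`, the first fact applies to the first field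
over which `d` is nondegenerate, and the second carries the bound up to `F`.
-/

namespace WeilSum

open IntermediateField IsDedekindDomain WithZero

/-! ### The valuation on the cyclotomic field -/

section ValuationFacts

variable (p : ℕ) [Fact p.Prime]

/-- The multiplicative valuation on `ℚ(e^{2πi/p})` at the prime `(e^{2πi/p} - 1)`. -/
noncomputable abbrev cycVal : Valuation (CycField p) ℤᵐ⁰ := (primeAbove p).valuation (CycField p)

theorem cycVal_gen_sub_one : cycVal p (AdjoinSimple.gen ℚ (zeta p) - 1) = exp (-1 : ℤ) := by
  have h := (primeAbove p).valuation_of_algebraMap (K := CycField p)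
    ((gen_isPrimitiveRoot p).toInteger - 1)
  rw [(primeAbove p).intValuation_singleton
    (gen_isPrimitiveRoot p).zeta_sub_one_prime'.ne_zero rfl] at h
  exact h

theorem cycVal_int_le_one (n : ℤ) : cycVal p n ≤ 1 := by
  simpa using (primeAbove p).valuation_le_one (K := CycField p)
    (n : NumberField.RingOfIntegers (CycField p))

theorem cycVal_int_lt_one_iff (n : ℤ) : cycVal p n < 1 ↔ (p : ℤ) ∣ n := by
  have h := (primeAbove p).valuation_lt_one_iff_mem (K := CycField p)
    (n : NumberField.RingOfIntegers (CycField p))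
  rw [← IsCyclotomicExtension.Rat.zeta_sub_one_dvd_intCast_iff' p (gen_isPrimitiveRoot p),
    ← Ideal.mem_span_singleton]
  have hc : ((n : NumberField.RingOfIntegers (CycField p)) : CycField p) = (n : CycField p) :=
    map_intCast _ n
  rw [← hc]
  exact h

theorem cycVal_prime : cycVal p (p : CycField p) = exp (-((p : ℤ) - 1)) := by
  obtain ⟨u, hu⟩ :=
    IsCyclotomicExtension.Rat.associated_zeta_sub_one_pow_prime p (gen_isPrimitiveRoot p)
  have hu1 : cycVal p ((u : NumberField.RingOfIntegers (CycField p)) : CycField p) = 1 := by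
    rw [(primeAbove p).valuation_eq_one_iff_notMem]
    exact fun h => (primeAbove p).isPrime.ne_top (Ideal.eq_top_of_isUnit_mem _ h u.isUnit)
  have h := congrArg
    (fun x : NumberField.RingOfIntegers (CycField p) => cycVal p (x : CycField p)) hu
  have h2 : cycVal p (((gen_isPrimitiveRoot p).toInteger - 1 :
      NumberField.RingOfIntegers (CycField p)) : CycField p) = exp (-1 : ℤ) := cycVal_gen_sub_one p
  simp only [map_mul, map_pow, hu1, mul_one, h2] at h
  have hc : ((p : NumberField.RingOfIntegers (CycField p)) : CycField p) = (p : CycField p) :=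
    map_natCast _ p
  rw [hc] at h
  rw [← h, ← exp_nsmul]
  have := (Fact.out : p.Prime).one_lt
  congr 1
  simp only [nsmul_eq_mul]
  push_cast [Nat.cast_sub this.le]
  ring

theorem valP_eq_div {x : CycField p} (hx : x ≠ 0) :
    valP p x = ((((-log (cycVal p x) : ℤ) : ℚ) / ((p : ℚ) - 1) : ℚ) : WithTop ℚ) :=
  if_neg hx

theorem le_valP_iff (k : ℤ) (x : CycField p) :
    (((k : ℚ) / ((p : ℚ) - 1) : ℚ) : WithTop ℚ) ≤ valP p x ↔ cycVal p x ≤ exp (-k) := by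
  have hp : (0 : ℚ) < (p : ℚ) - 1 := by
    have : (1 : ℚ) < p := by exact_mod_cast (Fact.out : p.Prime).one_lt
    linarith
  rcases eq_or_ne x 0 with rfl | hx
  · simp [valP]
  · have hv : cycVal p x ≠ 0 := (map_ne_zero _).2 hx
    rw [valP_eq_div p hx, WithTop.coe_le_coe, div_le_div_iff_of_pos_right hp, Int.cast_le,
      ← log_le_iff_le_exp hv]
    omega

theorem lt_valP_iff (k : ℤ) (x : CycField p) :
    (((k : ℚ) / ((p : ℚ) - 1) : ℚ) : WithTop ℚ) < valP p x ↔ cycVal p x < exp (-k) := by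
  have hp : (0 : ℚ) < (p : ℚ) - 1 := by
    have : (1 : ℚ) < p := by exact_mod_cast (Fact.out : p.Prime).one_lt
    linarith
  rcases eq_or_ne x 0 with rfl | hx
  · simp [valP]
  · have hv : cycVal p x ≠ 0 := (map_ne_zero _).2 hx
    rw [valP_eq_div p hx, WithTop.coe_lt_coe, div_lt_div_iff_of_pos_right hp, Int.cast_lt,
      ← log_lt_iff_lt_exp hv]
    omega

theorem le_valP_iff_le_pow (h : ℕ) (x : CycField p) :
    ((h : ℚ) : WithTop ℚ) ≤ valP p x ↔ cycVal p x ≤ cycVal p ((p : CycField p) ^ h) := by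
  have hp : (1 : ℚ) < p := by exact_mod_cast (Fact.out : p.Prime).one_lt
  have h1 := le_valP_iff p (h * ((p : ℤ) - 1)) x
  rw [map_pow, cycVal_prime, ← exp_nsmul]
  convert h1 using 3
  · push_cast
    rw [mul_div_cancel_right₀ _ (by linarith)]
  · rw [nsmul_eq_mul, mul_neg]

theorem lt_valP_iff_lt_pow (h : ℕ) (x : CycField p) :
    ((h : ℚ) : WithTop ℚ) < valP p x ↔ cycVal p x < cycVal p ((p : CycField p) ^ h) := by
  have hp : (1 : ℚ) < p := by exact_mod_cast (Fact.out : p.Prime).one_lt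
  have h1 := lt_valP_iff p (h * ((p : ℤ) - 1)) x
  rw [map_pow, cycVal_prime, ← exp_nsmul]
  convert h1 using 3
  · push_cast
    rw [mul_div_cancel_right₀ _ (by linarith)]
  · rw [nsmul_eq_mul, mul_neg]

/-- The group algebra of a finite commutative group of order prime to `p` is reduced in
characteristic `p`. Here this is the statement that a function whose convolution square vanishes is
zero: some `p ^ j`-th power map is the identity on the group, so the `p ^ j`-th power of an element
of the group algebra just raises its coefficients to that power. -/
theorem eq_zero_of_convolution_eq_zero {k G : Type*} [Field k] [CharP k p] [CommGroup G] [Fintype G]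
    [DecidableEq G] {j : ℕ} (hj : ∀ g : G, g ^ p ^ j = g) (hj0 : j ≠ 0) (f : G → k)
    (hf : ∀ b, ∑ g, f g * f (b * g⁻¹) = 0) (g : G) : f g = 0 := by
  have : CharP (MonoidAlgebra k G) p := charP_of_injective_algebraMap (R := k)
    (FaithfulSMul.algebraMap_injective k (MonoidAlgebra k G)) p
  set w : MonoidAlgebra k G := ∑ g, MonoidAlgebra.single g (f g) with hw
  have hw2 : w * w = 0 := by
    rw [hw, Finset.sum_mul_sum]
    have : ∀ g, ∑ h, MonoidAlgebra.single g (f g) * MonoidAlgebra.single h (f h) =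
        ∑ b, MonoidAlgebra.single b (f g * f (b * g⁻¹)) := by
      intro g
      rw [← Equiv.sum_comp (Equiv.mulLeft g)
        (fun b => MonoidAlgebra.single b (f g * f (b * g⁻¹)))]
      simp [MonoidAlgebra.single_mul_single]
    simp_rw [this]
    rw [Finset.sum_comm]
    refine Finset.sum_eq_zero fun b _ => ?_
    have h := congrArg (MonoidAlgebra.single b) (hf b)
    rw [MonoidAlgebra.single_zero] at h
    rw [← h]
    exact (map_sum (MonoidAlgebra.singleAddHom b) _ _).symm
  have hpow : w ^ p ^ j = ∑ g, MonoidAlgebra.single g (f g ^ p ^ j) := by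
    rw [hw, sum_pow_char_pow]
    simp [MonoidAlgebra.single_pow, hj]
  have h2 : 2 ≤ p ^ j := (Fact.out : p.Prime).two_le.trans (Nat.le_self_pow hj0 p)
  have h0 : w ^ p ^ j = 0 := by
    rw [← Nat.add_sub_cancel' h2, pow_add, pow_two, hw2, zero_mul]
  have h3 := congrArg (fun z : MonoidAlgebra k G => z.coeff g) (hpow.symm.trans h0)
  simp only [MonoidAlgebra.coeff_sum, Finsupp.finsetSum_apply, MonoidAlgebra.coeff_single,
    Finsupp.single_apply] at h3
  rw [Finset.sum_ite_eq' Finset.univ g, if_pos (Finset.mem_univ g)] at h3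
  exact eq_zero_of_pow_eq_zero h3

end ValuationFacts

/-! ### The canonical character and moments of Weil sums -/

section TraceCharacter

variable (p : ℕ) [Fact p.Prime] (F : Type*) [Field F] [Algebra (ZMod p) F]

/-- The canonical additive character of `F`, bundled as an `AddChar`. -/
noncomputable def traceChar : AddChar F ℂ :=
  AddChar.compAddMonoidHom ZMod.stdAddChar (Algebra.trace (ZMod p) F).toAddMonoidHom

theorem traceChar_apply (x : F) :
    traceChar p F x = ZMod.stdAddChar (Algebra.trace (ZMod p) F x) := rfl

theorem canonicalChar_eq_traceChar (x : F) : canonicalChar p F x = traceChar p F x := by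
  rw [traceChar_apply, ZMod.stdAddChar_apply, ZMod.toCircle_apply]
  rfl

theorem norm_traceChar (x : F) : ‖traceChar p F x‖ = 1 := by
  rw [traceChar_apply, ZMod.stdAddChar_apply]
  exact Circle.norm_coe _

theorem traceChar_eq_one_iff (x : F) : traceChar p F x = 1 ↔ Algebra.trace (ZMod p) F x = 0 := by
  rw [traceChar_apply, ← AddChar.map_zero_eq_one (ZMod.stdAddChar (N := p)),
    ZMod.injective_stdAddChar.eq_iff]

theorem conj_traceChar (x : F) : (starRingEnd ℂ) (traceChar p F x) = traceChar p F (-x) := by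
  rw [AddChar.map_neg_eq_inv, Complex.inv_eq_conj (norm_traceChar p F x)]

theorem traceChar_algebraMap_trace {L : Type*} [Field L] [Algebra (ZMod p) L] [Algebra L F]
    [IsScalarTower (ZMod p) L F] [Finite F] [Finite L] (x : F) :
    traceChar p L (Algebra.trace L F x) = traceChar p F x := by
  rw [traceChar_apply, traceChar_apply, Algebra.trace_trace]

section Finite

variable [Fintype F]

theorem traceChar_pow_prime_pow (k : ℕ) (x : F) :
    traceChar p F (x ^ p ^ k) = traceChar p F x := by
  have h := Algebra.trace_eq_of_algEquiv
    (FiniteField.frobeniusAlgEquivOfAlgebraic (ZMod p) F ^ k) x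
  have h2 : (FiniteField.frobeniusAlgEquivOfAlgebraic (ZMod p) F ^ k) x = x ^ p ^ k := by
    rw [AlgEquiv.coe_pow, FiniteField.coe_frobeniusAlgEquivOfAlgebraic_iterate, ZMod.card]
  rw [traceChar_apply, traceChar_apply, ← h, h2]

theorem traceChar_isPrimitive : (traceChar p F).IsPrimitive := by
  intro a ha h
  have : a = 0 := by
    refine (traceForm_nondegenerate (ZMod p) F).1 a fun y => ?_
    rw [Algebra.traceForm_apply, ← traceChar_eq_one_iff]
    simpa using DFunLike.congr_fun h y
  exact ha this

theorem sum_traceChar_mul [DecidableEq F] (b : F) :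
    ∑ x : F, traceChar p F (x * b) = if b = 0 then (Fintype.card F : ℂ) else 0 := by
  rw [AddChar.sum_mulShift b (traceChar_isPrimitive p F)]
  split_ifs <;> simp

theorem sum_traceChar : ∑ x : F, traceChar p F x = 0 := by
  classical
  simpa using sum_traceChar_mul p F 1

theorem weilSum_eq (d : ℕ) (a : F) :
    weilSum p F d a = ∑ x : F, traceChar p F (x ^ d - a * x) := by
  simp only [weilSum, canonicalChar_eq_traceChar]

theorem norm_weilSum_le (d : ℕ) (a : F) : ‖weilSum p F d a‖ ≤ Fintype.card F := by
  rw [weilSum_eq]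
  exact (norm_sum_le _ _).trans (by simp)

theorem sum_weilSum {d : ℕ} (hd : d ≠ 0) : ∑ a : F, weilSum p F d a = Fintype.card F := by
  classical
  simp_rw [weilSum_eq, sub_eq_add_neg, AddChar.map_add_eq_mul]
  rw [Finset.sum_comm]
  simp_rw [← Finset.mul_sum, ← mul_neg, sum_traceChar_mul]
  simp [hd]

theorem sum_weilSum_mul_conj (d : ℕ) :
    ∑ a : F, weilSum p F d a * (starRingEnd ℂ) (weilSum p F d a) = (Fintype.card F : ℂ) ^ 2 := by
  classical
  simp_rw [weilSum_eq, map_sum, conj_traceChar, Finset.sum_mul_sum, ← AddChar.map_add_eq_mul]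
  rw [Finset.sum_comm]
  have : ∀ x y : F, ∑ a : F, traceChar p F (x ^ d - a * x + -(y ^ d - a * y)) =
      if y = x then (Fintype.card F : ℂ) else 0 := by
    intro x y
    have h : ∀ a : F, x ^ d - a * x + -(y ^ d - a * y) = (x ^ d - y ^ d) + a * (y - x) := by
      intro a; ring
    simp_rw [h, AddChar.map_add_eq_mul, ← Finset.mul_sum, sum_traceChar_mul, sub_eq_zero]
    split_ifs with h1
    · simp [h1]
    · simp
  refine (Finset.sum_congr rfl fun x _ => Finset.sum_comm).trans ?_
  simp_rw [this]
  simp [pow_two]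

/-- Raising to the power `d` permutes `F` when `d` is prime to `|F| - 1`. -/
theorem pow_bijective {d : ℕ} (hd : d ≠ 0) (hcop : d.Coprime (Nat.card F - 1)) :
    Function.Bijective fun x : F => x ^ d := by
  classical
  rw [← Finite.injective_iff_bijective]
  intro x y hxy
  simp only at hxy
  rcases eq_or_ne y 0 with rfl | hy
  · rw [zero_pow hd] at hxy
    exact eq_zero_of_pow_eq_zero hxy
  · have hx : x ≠ 0 := by
      rintro rfl
      rw [zero_pow hd] at hxy
      exact hy (eq_zero_of_pow_eq_zero hxy.symm)
    have hu : (Units.mk0 x hx) ^ d = (Units.mk0 y hy) ^ d := by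
      ext; simpa using hxy
    have hc : (Nat.card Fˣ).Coprime d := by
      rw [Nat.card_units]; exact hcop.symm
    simpa using congrArg Units.val ((powCoprime hc).injective hu)

/-- If some Weil sum has the trivial value `|F|`, then `x ↦ x ^ d` is additive, hence an
automorphism of `F`, and so `d` is degenerate. -/
theorem isDegenerate_of_weilSum_eq_card {d : ℕ} (hd : d ≠ 0) (hcop : d.Coprime (Nat.card F - 1))
    {a : F} (ha : weilSum p F d a = Fintype.card F) : IsDegenerate p F d := by
  have hbij := pow_bijective F hd hcop
  -- A sum of `|F|` complex numbers of modulus `1` equals `|F|` only if each of them is `1`.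
  have hone : ∀ x : F, traceChar p F (x ^ d - a * x) = 1 := by
    have hle : ∀ x : F, (traceChar p F (x ^ d - a * x)).re ≤ 1 := fun x =>
      (Complex.re_le_norm _).trans (norm_traceChar p F _).le
    have hsum : ∑ x : F, (traceChar p F (x ^ d - a * x)).re = ∑ _x : F, (1 : ℝ) := by
      rw [← Complex.re_sum, ← weilSum_eq, ha]
      simp
    intro x
    have h1 := (Finset.sum_eq_sum_iff_of_le (fun x _ => hle x)).1 hsum x (Finset.mem_univ x)
    have h2 := norm_traceChar p F (x ^ d - a * x)
    have h3 := Complex.sq_norm (traceChar p F (x ^ d - a * x))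
    rw [h2, Complex.normSq_apply, h1] at h3
    refine Complex.ext h1 ?_
    simp only [Complex.one_im]
    nlinarith
  have htr : ∀ x : F, Algebra.trace (ZMod p) F (x ^ d) = Algebra.trace (ZMod p) F (a * x) := by
    intro x
    have := (traceChar_eq_one_iff p F _).1 (hone x)
    rwa [map_sub, sub_eq_zero] at this
  have hadd : ∀ x y : F, (x + y) ^ d = x ^ d + y ^ d := by
    intro x y
    -- As `d`-th powers exhaust `F`, it suffices to test against them with the trace form.
    rw [← sub_eq_zero]
    refine (traceForm_nondegenerate (ZMod p) F).1 _ fun z => ?_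
    obtain ⟨c, rfl⟩ := hbij.2 z
    have h1 := htr ((x + y) * c)
    have h2 := htr (x * c)
    have h3 := htr (y * c)
    rw [Algebra.traceForm_apply, sub_mul, add_mul, map_sub, map_add, ← mul_pow, ← mul_pow,
      ← mul_pow, h1, h2, h3, add_mul, mul_add, map_add, sub_self]
  let σ : F →+* F :=
    { toFun := fun x => x ^ d
      map_one' := one_pow d
      map_mul' := fun x y => mul_pow x y d
      map_zero' := zero_pow hd
      map_add' := hadd }
  have hσ : ∀ c, σ (algebraMap (ZMod p) F c) = algebraMap (ZMod p) F c :=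
    DFunLike.congr_fun (Subsingleton.elim (σ.comp (algebraMap (ZMod p) F)) (algebraMap _ _))
  let τ : F →ₐ[ZMod p] F := { σ with commutes' := hσ }
  obtain ⟨k, hk⟩ := FiniteField.exists_forall_apply_eq_pow (ZMod p) p F
    (AlgEquiv.ofBijective τ hbij)
  refine ⟨k, ?_⟩
  obtain ⟨g, hg⟩ := IsCyclic.exists_generator (α := Fˣ)
  have hgd : g ^ d = g ^ p ^ k := by
    ext
    have := hk (g : F)
    rw [Nat.card_zmod] at this
    simp only [Units.val_pow_eq_pow_val]
    exact this
  have := (pow_eq_pow_iff_modEq).1 hgd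
  rwa [orderOf_eq_card_of_forall_mem_zpowers hg, Nat.card_units] at this

end Finite
end TraceCharacter

/-! ### Exponents degenerate over the subfield of order the square root -/

section HalfDegree

variable (p : ℕ) [Fact p.Prime] (F : Type*) [Field F]

theorem exists_pow_eq_of_isDegenerate [Finite F] {K : Subfield F} {d : ℕ} (hd : d ≠ 0)
    (hK : IsDegenerate p K d) : ∃ k : ℕ, ∀ y : K, y ^ d = y ^ p ^ k := by
  obtain ⟨k, hk⟩ := hK
  refine ⟨k, fun y => ?_⟩
  rcases eq_or_ne y 0 with rfl | hy
  · rw [zero_pow hd, zero_pow (pow_ne_zero _ (Fact.out : p.Prime).ne_zero)]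
  · have h : (Units.mk0 y hy) ^ d = (Units.mk0 y hy) ^ p ^ k := by
      rw [pow_eq_pow_iff_modEq]
      refine hk.of_dvd ?_
      rw [← Nat.card_units]
      exact orderOf_dvd_natCard _
    simpa using congrArg Units.val h

variable [Algebra (ZMod p) F]

theorem sum_traceChar_subfield (K : Subfield F) [Fintype K] (z : F)
    [Decidable (∀ y : K, traceChar p F (y * z) = 1)] :
    ∑ y : K, traceChar p F (y * z) =
      if ∀ y : K, traceChar p F (y * z) = 1 then (Fintype.card K : ℂ) else 0 := by
  classical
  let χ : AddChar K ℂ := AddChar.compAddMonoidHom (traceChar p F)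
    ((AddMonoidHom.mulRight z).comp K.subtype.toAddMonoidHom)
  have h := AddChar.sum_eq_ite χ
  have hiff : χ = 0 ↔ ∀ y : K, traceChar p F (y * z) = 1 := by
    rw [AddChar.eq_zero_iff]
    rfl
  simp only [hiff] at h
  exact h

variable [Fintype F]

/-- When `d` is degenerate over the subfield `K` of order `r = √q`, averaging over the scalings
`x ↦ y x` with `y ∈ K` makes the Weil sum count the `x ∈ F` for which a character of `K` is
trivial. The set counted is stable under scaling by `K`, so it is `{0}` or has at least
`r` elements. -/
theorem exists_count_of_isDegenerate_subfield {K : Subfield F} (hK : Nat.card K ^ 2 = Nat.card F)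
    {d : ℕ} (hd : d ≠ 0) (hdK : IsDegenerate p K d) (a : F) :
    ∃ M : ℕ, (M = 1 ∨ Nat.card K ≤ M) ∧
      ((Nat.card K : ℂ) - 1) * weilSum p F d a = Nat.card K * ((M : ℂ) - Nat.card K) := by
  classical
  obtain ⟨k, hk⟩ := exists_pow_eq_of_isDegenerate p F hd hdK
  have hp0 : p ^ k ≠ 0 := pow_ne_zero _ (Fact.out : p.Prime).ne_zero
  have : CharP F p := charP_of_injective_algebraMap (algebraMap (ZMod p) F).injective p
  have hkF : ∀ y : K, (y : F) ^ d = (y : F) ^ p ^ k := fun y => by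
    exact_mod_cast congrArg Subtype.val (hk y)
  let z : F → F := fun x => x ^ d - (a * x) ^ p ^ k
  let S : Finset F := Finset.univ.filter fun x => ∀ y : K, traceChar p F (y * z x) = 1
  have hz : ∀ (y : K) (x : F), z (y * x) = (y : F) ^ p ^ k * z x := by
    intro y x
    simp only [z, mul_pow, hkF]
    ring
  have hFrob : Function.Bijective fun y : K => y ^ p ^ k := by
    have : CharP K p := (algebraMap K F).charP (algebraMap K F).injective p
    rw [← Finite.injective_iff_bijective]
    exact iterateFrobenius_inj K p k
  have h0 : (0 : F) ∈ S := by
    simp [S, z, hd, zero_pow hp0]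
  have hS : ∀ (y : K) (x : F), x ∈ S → (y : F) * x ∈ S := by
    intro y x hx
    simp only [S, Finset.mem_filter, Finset.mem_univ, true_and] at hx ⊢
    intro y'
    rw [hz]
    simpa [mul_assoc] using hx (y' * y ^ p ^ k)
  refine ⟨S.card, ?_, ?_⟩
  · rcases Finset.eq_singleton_or_nontrivial h0 with h | h
    · left; rw [h]; simp
    · right
      obtain ⟨x, hx, hx0⟩ := h.exists_ne 0
      rw [Nat.card_eq_fintype_card, ← Finset.card_univ]
      refine Finset.card_le_card_of_injOn (fun y : K => (y : F) * x) (fun y _ => hS y x hx) ?_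
      intro y _ y' _ h
      exact Subtype.ext (mul_right_cancel₀ hx0 h)
  · -- The linear term is raised to the power `p ^ k`, which the trace does not see, so that `y` enters
    -- both terms through `y ^ p ^ k`.
    have hterm : ∀ (y : K) (x : F), traceChar p F ((y * x) ^ d - a * (y * x)) =
        traceChar p F ((y ^ p ^ k : K) * z x) := by
      intro y x
      rw [sub_eq_add_neg, AddChar.map_add_eq_mul, AddChar.map_neg_eq_inv,
        ← traceChar_pow_prime_pow p F k (a * (y * x)), ← AddChar.map_neg_eq_inv,
        ← AddChar.map_add_eq_mul, ← sub_eq_add_neg]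
      congr 1
      simp only [z, mul_pow, hkF]
      push_cast
      ring
    have hinner : ∀ y : K, ∑ x : F, traceChar p F ((y * x) ^ d - a * (y * x)) =
        if y = 0 then (Fintype.card F : ℂ) else weilSum p F d a := by
      intro y
      split_ifs with hy
      · simp [hy, hd]
      · have hyF : (y : F) ≠ 0 := by simpa using hy
        rw [weilSum_eq]
        exact Equiv.sum_comp (Equiv.mulLeft₀ (y : F) hyF) fun x => traceChar p F (x ^ d - a * x)
    have hdouble : ∑ y : K, ∑ x : F, traceChar p F ((y * x) ^ d - a * (y * x)) =
        S.card * (Nat.card K : ℂ) := by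
      rw [Finset.sum_comm]
      simp_rw [hterm]
      have : ∀ x : F, ∑ y : K, traceChar p F ((y ^ p ^ k : K) * z x) =
          if ∀ y : K, traceChar p F (y * z x) = 1 then (Nat.card K : ℂ) else 0 := by
        intro x
        rw [Nat.card_eq_fintype_card, ← sum_traceChar_subfield]
        exact hFrob.sum_comp fun y : K => traceChar p F (y * z x)
      simp_rw [this]
      rw [← Finset.sum_filter]
      simp [S]
    simp_rw [hinner] at hdouble
    rw [Finset.sum_ite, Finset.sum_const, Finset.sum_const, Finset.filter_ne',
      Finset.card_erase_of_mem (Finset.mem_univ _), Finset.filter_eq', if_pos (Finset.mem_univ _),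
      Finset.card_singleton, one_smul, Finset.card_univ, nsmul_eq_mul,
      Nat.cast_sub Fintype.card_pos, Nat.cast_one, ← Nat.card_eq_fintype_card,
      ← Nat.card_eq_fintype_card, ← hK] at hdouble
    push_cast at hdouble
    linear_combination hdouble

/-- If all Weil sums are nonnegative reals, one of them equals `q = |F|`: none exceeds `q`, their
sum is `q` and the sum of their squares is `q ^ 2`. -/
theorem exists_weilSum_eq_card {d : ℕ} (hd : d ≠ 0) {w : F → ℝ} (hw : ∀ a, weilSum p F d a = w a)
    (hw0 : ∀ a, 0 ≤ w a) : ∃ a, weilSum p F d a = Fintype.card F := by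
  have h1 : ∑ a, w a = Fintype.card F := by
    have := sum_weilSum p F hd
    simp_rw [hw] at this
    exact_mod_cast this
  have h2 : ∑ a, w a * w a = (Fintype.card F : ℝ) ^ 2 := by
    have := sum_weilSum_mul_conj p F d
    simp_rw [hw, Complex.conj_ofReal] at this
    exact_mod_cast this
  have hle : ∀ a, w a ≤ Fintype.card F := fun a => by
    have := norm_weilSum_le p F d a
    rw [hw, Complex.norm_real] at this
    exact (le_abs_self _).trans this
  have h3 : ∑ a, w a * (Fintype.card F - w a) = 0 := by
    simp_rw [mul_sub]
    rw [Finset.sum_sub_distrib, ← Finset.sum_mul, h1, h2]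
    ring
  rw [Finset.sum_eq_zero_iff_of_nonneg
    fun a _ => mul_nonneg (hw0 a) (sub_nonneg.2 (hle a))] at h3
  by_contra! hne
  have h4 : ∀ a, w a = 0 := fun a => by
    refine (mul_eq_zero.1 (h3 a (Finset.mem_univ a))).resolve_right fun h => hne a ?_
    rw [hw, ← sub_eq_zero.1 h]
    simp
  have h5 : (Fintype.card F : ℝ) ≠ 0 := by exact_mod_cast Fintype.card_ne_zero
  exact h5 (by rw [← h1]; simp [h4])

/-- If `d` is nondegenerate over `F` but degenerate over the subfield of order `√q`, then
`V_{F,d}` is half the degree of `F`. -/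
theorem minVal_eq_of_isDegenerate_subfield {K : Subfield F} (hK : Nat.card K ^ 2 = Nat.card F)
    {d : ℕ} (hd : d ≠ 0) (hcop : d.Coprime (Nat.card F - 1)) (hnd : ¬ IsDegenerate p F d)
    (hdK : IsDegenerate p K d) :
    minVal p F d = (((Module.finrank (ZMod p) F : ℚ) / 2 : ℚ) : WithTop ℚ) := by
  classical
  have hp := (Fact.out : p.Prime)
  have h1 : Nat.card F = p ^ Module.finrank (ZMod p) F := by
    rw [Module.natCard_eq_pow_finrank (K := ZMod p), Nat.card_zmod]
  obtain ⟨h, -, hh⟩ := (Nat.dvd_prime_pow hp).1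
    (show Nat.card K ∣ p ^ Module.finrank (ZMod p) F from
      (dvd_pow_self _ two_ne_zero).trans (hK.trans h1).dvd)
  have hm : ((Module.finrank (ZMod p) F : ℚ) / 2 : ℚ) = (h : ℚ) := by
    rw [← hK, hh, ← pow_mul] at h1
    rw [← Nat.pow_right_injective hp.two_le h1]
    push_cast
    ring
  rw [hm]
  have hr : 1 < Nat.card K := Finite.one_lt_card
  have hrdvd : p ∣ Nat.card K := by
    rw [hh] at hr ⊢
    exact dvd_pow_self p (by rintro rfl; exact hr.ne (pow_zero p).symm)
  choose M hM1 hM2 using exists_count_of_isDegenerate_subfield p F hK hd hdK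
  have hval : ∀ a, cycVal p ⟨weilSum p F d a, weilSum_mem p F d a⟩ =
      cycVal p ((p : CycField p) ^ h) * cycVal p (((M a : ℤ) - Nat.card K : ℤ) : CycField p) := by
    intro a
    have h1 : (((Nat.card K : ℤ) - 1 : ℤ) : CycField p) * ⟨weilSum p F d a, weilSum_mem p F d a⟩ =
        (p : CycField p) ^ h * (((M a : ℤ) - Nat.card K : ℤ) : CycField p) := by
      apply Subtype.ext
      have := hM2 a
      rw [hh] at this ⊢
      push_cast at this ⊢
      exact this
    have h2 : cycVal p (((Nat.card K : ℤ) - 1 : ℤ) : CycField p) = 1 := by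
      refine le_antisymm (cycVal_int_le_one p _) (not_lt.1 fun hlt => ?_)
      rw [cycVal_int_lt_one_iff, dvd_sub_right (by exact_mod_cast hrdvd)] at hlt
      exact hp.one_lt.ne' (by exact_mod_cast Int.eq_one_of_dvd_one (by positivity) hlt)
    rw [← map_mul, ← h1, map_mul, h2, one_mul]
  refine le_antisymm ?_ ?_
  · -- Otherwise `p` divides every count, so all Weil sums are nonnegative.
    by_contra! hlt
    have hMr : ∀ a, Nat.card K ≤ M a := by
      intro a
      refine (hM1 a).resolve_left fun h1 => ?_
      have h2 := (Finset.lt_inf'_iff _).1 hlt a (Finset.mem_univ a)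
      rw [lt_valP_iff_lt_pow, hval, mul_lt_iff_lt_one_right, cycVal_int_lt_one_iff,
        dvd_sub_left (by exact_mod_cast hrdvd), h1] at h2
      · exact hp.one_lt.ne' (by exact_mod_cast Int.eq_one_of_dvd_one (by positivity) h2)
      · rw [zero_lt_iff, map_ne_zero]
        exact pow_ne_zero _ (by exact_mod_cast hp.ne_zero)
    have hr' : (0 : ℝ) < (Nat.card K : ℝ) - 1 := by
      rw [sub_pos]; exact_mod_cast hr
    obtain ⟨a, ha⟩ := exists_weilSum_eq_card p F hd
      (w := fun a => Nat.card K * ((M a : ℝ) - Nat.card K) / ((Nat.card K : ℝ) - 1))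
      (fun a => by
        have hne : (Nat.card K : ℂ) - 1 ≠ 0 := by exact_mod_cast hr'.ne'
        push_cast
        rw [eq_div_iff hne, ← hM2 a, mul_comm])
      (fun a => div_nonneg (mul_nonneg (Nat.cast_nonneg _)
        (sub_nonneg.2 (by exact_mod_cast hMr a))) hr'.le)
    exact hnd (isDegenerate_of_weilSum_eq_card p F hd hcop ha)
  · refine (Finset.le_inf'_iff _ _).2 fun a _ => ?_
    rw [le_valP_iff_le_pow, hval]
    exact mul_le_of_le_one_right' (cycVal_int_le_one p _)

end HalfDegree

/-! ### Weil sums in quadratic extensions -/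

section QuadraticExtension

variable (L F : Type*) [Field L] [Fintype L] [Field F] [Fintype F] [Algebra L F]

/-- The norm of `F` over `L` as a map of unit groups. -/
noncomputable abbrev unitsNorm : Fˣ →* Lˣ := Units.map (Algebra.norm L : F →* L)

section Counting

variable (hLF : Module.finrank L F = 2)
include hLF

theorem card_eq_sq_of_quadratic : Fintype.card F = Fintype.card L ^ 2 := by
  rw [Module.card_eq_pow_finrank (K := L), hLF]

theorem algebraMap_trace_of_quadratic (x : F) :
    algebraMap L F (Algebra.trace L F x) = x + x ^ Fintype.card L := by
  rw [FiniteField.algebraMap_trace_eq_sum_pow, hLF, Finset.sum_range_succ, Finset.sum_range_one,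
    pow_zero, pow_one, pow_one, Nat.card_eq_fintype_card]

theorem algebraMap_norm_of_quadratic (x : F) :
    algebraMap L F (Algebra.norm L x) = x * x ^ Fintype.card L := by
  obtain ⟨m, hm⟩ : ∃ m, Fintype.card L = m + 1 := ⟨_, (Nat.succ_pred Fintype.card_ne_zero).symm⟩
  have hm0 : 0 < m := by
    have := Fintype.one_lt_card (α := L)
    omega
  rw [FiniteField.algebraMap_norm_eq_pow, Nat.card_eq_fintype_card, Nat.card_eq_fintype_card,
    card_eq_sq_of_quadratic L F hLF, ← pow_succ', hm, Nat.add_sub_cancel,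
    Nat.div_eq_of_eq_mul_left hm0]
  rw [Nat.sub_eq_of_eq_add]
  ring

variable [DecidableEq L] [DecidableEq F]

theorem card_units_of_quadratic :
    Fintype.card Fˣ = (Fintype.card L + 1) * Fintype.card Lˣ := by
  obtain ⟨m, hm⟩ : ∃ m, Fintype.card L = m + 1 := ⟨_, (Nat.succ_pred Fintype.card_ne_zero).symm⟩
  rw [Fintype.card_units, Fintype.card_units, card_eq_sq_of_quadratic L F hLF, hm,
    Nat.add_sub_cancel, Nat.sub_eq_of_eq_add]
  ring

theorem card_unitsNorm_fiber (b : Lˣ) :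
    (Finset.univ.filter fun x : Fˣ => unitsNorm L F x = b).card = Fintype.card L + 1 := by
  have hsurj := FiniteField.unitsMap_norm_surjective L F
  have h := Finset.card_eq_sum_card_fiberwise (s := (Finset.univ : Finset Fˣ))
    (t := (Finset.univ : Finset Lˣ)) (f := unitsNorm L F) (fun _ _ => Finset.mem_univ _)
  have h2 : ∀ c : Lˣ, (Finset.univ.filter fun x : Fˣ => unitsNorm L F x = c).card =
      (Finset.univ.filter fun x : Fˣ => unitsNorm L F x = b).card := fun c =>
    MonoidHom.card_fiber_eq_of_mem_range (unitsNorm L F) (hsurj c) (hsurj b)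
  rw [Finset.sum_congr rfl fun c _ => h2 c, Finset.sum_const, Finset.card_univ, Finset.card_univ,
    smul_eq_mul, card_units_of_quadratic L F hLF, mul_comm] at h
  exact (Nat.eq_of_mul_eq_mul_left Fintype.card_pos h).symm

/-- Both the `y` in `L` with `y + n / y = t` and the `x` in `F` with trace `t` and norm `n` are roots
of `X ^ 2 - t X + n`; a root of both kinds is a double root. -/
theorem card_add_card_le_two (n : Lˣ) (t : L) :
    (Finset.univ.filter fun y : Lˣ => (y : L) + n * (y⁻¹ : Lˣ) = t).card +
      (Finset.univ.filter fun x : Fˣ => unitsNorm L F x = n ∧ Algebra.trace L F x = t).card ≤ 2 := by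
  set A := Finset.univ.filter fun y : Lˣ => (y : L) + n * (y⁻¹ : Lˣ) = t with hA
  set B := Finset.univ.filter fun x : Fˣ => unitsNorm L F x = n ∧ Algebra.trace L F x = t with hB
  let T : Finset F := Finset.univ.filter fun u : F =>
    u * u - algebraMap L F t * u + algebraMap L F n = 0
  let A' : Finset F := A.image fun y : Lˣ => algebraMap L F y
  let B' : Finset F := B.image fun x : Fˣ => (x : F)
  have hAcard : A'.card = A.card := Finset.card_image_of_injective _
    ((algebraMap L F).injective.comp Units.val_injective)
  have hBcard : B'.card = B.card := Finset.card_image_of_injective _ Units.val_injective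
  have hBT : ∀ x ∈ B, (x : F) + (x : F) ^ Fintype.card L = algebraMap L F t ∧
      (x : F) * (x : F) ^ Fintype.card L = algebraMap L F n := by
    intro x hx
    simp only [hB, Finset.mem_filter, Finset.mem_univ, true_and] at hx
    rw [← algebraMap_norm_of_quadratic L F hLF, ← algebraMap_trace_of_quadratic L F hLF, hx.2,
      ← hx.1]
    exact ⟨rfl, rfl⟩
  have hA'T : A' ⊆ T := by
    intro u hu
    obtain ⟨y, hy, rfl⟩ := Finset.mem_image.1 hu
    simp only [hA, Finset.mem_filter, Finset.mem_univ, true_and] at hy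
    simp only [T, Finset.mem_filter, Finset.mem_univ, true_and]
    rw [← map_mul, ← map_mul, ← map_sub, ← map_add, ← hy, map_eq_zero, add_mul,
      mul_assoc, Units.inv_mul]
    ring
  have hB'T : B' ⊆ T := by
    intro u hu
    obtain ⟨x, hx, rfl⟩ := Finset.mem_image.1 hu
    simp only [T, Finset.mem_filter, Finset.mem_univ, true_and]
    rw [← (hBT x hx).1, ← (hBT x hx).2]
    ring
  rw [← hAcard, ← hBcard]
  by_cases hdisj : Disjoint A' B'
  · rw [← Finset.card_union_of_disjoint hdisj]
    refine (Finset.card_le_card (Finset.union_subset hA'T hB'T)).trans ?_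
    rcases T.eq_empty_or_nonempty with h | ⟨u, hu⟩
    · simp [h]
    · refine (Finset.card_le_card (t := {u, algebraMap L F t - u}) ?_).trans Finset.card_le_two
      intro v hv
      simp only [T, Finset.mem_filter, Finset.mem_univ, true_and] at hu hv
      have : (v - u) * (v - (algebraMap L F t - u)) = 0 := by linear_combination hv - hu
      rcases mul_eq_zero.1 this with h | h
      · simp [sub_eq_zero.1 h]
      · simp [sub_eq_zero.1 h]
  · -- A common element is a double root of the quadratic, hence its only root.
    obtain ⟨u, huA, huB⟩ := Finset.not_disjoint_iff.1 hdisj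
    have hT : T ⊆ {u} := by
      obtain ⟨y, hy, rfl⟩ := Finset.mem_image.1 huA
      obtain ⟨x, hx, hxy⟩ := Finset.mem_image.1 huB
      obtain ⟨h1, h2⟩ := hBT x hx
      rw [hxy, ← map_pow, FiniteField.pow_card] at h1 h2
      intro v hv
      simp only [T, Finset.mem_filter, Finset.mem_univ, true_and] at hv
      have : (v - algebraMap L F y) ^ 2 = 0 := by
        rw [← h1, ← h2] at hv
        linear_combination hv
      rw [Finset.mem_singleton]
      exact sub_eq_zero.1 (pow_eq_zero_iff two_ne_zero |>.1 this)
    have h1 := Finset.card_le_card (hA'T.trans hT)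
    have h2 := Finset.card_le_card (hB'T.trans hT)
    rw [Finset.card_singleton] at h1 h2
    omega

theorem card_add_card_eq_two (n : Lˣ) (t : L) :
    (Finset.univ.filter fun y : Lˣ => (y : L) + n * (y⁻¹ : Lˣ) = t).card +
      (Finset.univ.filter fun x : Fˣ => unitsNorm L F x = n ∧ Algebra.trace L F x = t).card = 2 := by
  -- Both sides have the same sum over `t`, namely `(r - 1) + (r + 1) = 2 r` with `r = |L|`.
  refine (Finset.sum_eq_sum_iff_of_le (fun t _ => card_add_card_le_two L F hLF n t)).1 ?_ t
    (Finset.mem_univ t)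
  rw [Finset.sum_add_distrib]
  have h1 := Finset.card_eq_sum_card_fiberwise (s := (Finset.univ : Finset Lˣ))
    (t := (Finset.univ : Finset L)) (f := fun y : Lˣ => (y : L) + n * (y⁻¹ : Lˣ))
    (fun _ _ => Finset.mem_univ _)
  have h2 := Finset.card_eq_sum_card_fiberwise
    (s := Finset.univ.filter fun x : Fˣ => unitsNorm L F x = n)
    (t := (Finset.univ : Finset L)) (f := fun x : Fˣ => Algebra.trace L F x)
    (fun _ _ => Finset.mem_univ _)
  simp only [Finset.filter_filter] at h2
  rw [← h1, ← h2, card_unitsNorm_fiber L F hLF, Finset.card_univ, Fintype.card_units]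
  have := Fintype.card_pos (α := L)
  simp only [Finset.sum_const, Finset.card_univ, smul_eq_mul]
  omega

end Counting

variable [DecidableEq L] [DecidableEq F]
variable (p : ℕ) [Fact p.Prime] [Algebra (ZMod p) L]

/-- The Kloosterman sum `∑_{yz = n} ψ(y + z)` over `L`. -/
noncomputable def kloosterman (n : Lˣ) : ℂ := ∑ y : Lˣ, traceChar p L (y + n * (y⁻¹ : Lˣ))

theorem kloosterman_pow {d : ℕ} (hcop : (Nat.card Lˣ).Coprime d) (n : Lˣ) :
    kloosterman L p (n ^ d) =
      ∑ y : Lˣ, traceChar p L ((y : L) ^ d + ((n * y⁻¹ : Lˣ) : L) ^ d) := by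
  rw [kloosterman, ← Equiv.sum_comp (powCoprime hcop)]
  refine Finset.sum_congr rfl fun y _ => ?_
  simp [mul_pow]

theorem sum_units_traceChar : ∑ x : Lˣ, traceChar p L x = -1 := by
  have h := sum_traceChar p L
  rw [← Finset.add_sum_erase _ _ (Finset.mem_univ (0 : L)), AddChar.map_zero_eq_one] at h
  rw [← eq_neg_of_add_eq_zero_right h, Finset.sum_subtype (p := fun x : L => x ≠ 0) _ (by simp)]
  exact Equiv.sum_comp unitsEquivNeZero fun x : {x : L // x ≠ 0} => traceChar p L x

theorem weilSum_eq_units {d : ℕ} (hd : d ≠ 0) (a : L) :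
    weilSum p L d a = 1 + ∑ x : Lˣ, traceChar p L ((x : L) ^ d - a * x) := by
  rw [weilSum_eq, ← Finset.add_sum_erase _ _ (Finset.mem_univ (0 : L)),
    Finset.sum_subtype (p := fun x : L => x ≠ 0) _ (by simp)]
  congr 1
  · simp [hd]
  · exact (Equiv.sum_comp unitsEquivNeZero
      fun x : {x : L // x ≠ 0} => traceChar p L ((x : L) ^ d - a * x)).symm

variable [Algebra (ZMod p) F] [IsScalarTower (ZMod p) L F]

/-- The sum of the canonical character over a fibre of the norm is the negative of a Kloosterman
sum: for each trace and norm, the pairs in `L × L` and the elements of `F` together number `2`.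
This is the Hasse-Davenport relation for quadratic extensions, before Fourier transform. -/
theorem sum_norm_fiber (hLF : Module.finrank L F = 2) (n : Lˣ) :
    ∑ x : Fˣ with unitsNorm L F x = n, traceChar p F x = -kloosterman L p n := by
  rw [eq_neg_iff_add_eq_zero, add_comm, kloosterman,
    ← Finset.sum_fiberwise Finset.univ (fun y : Lˣ => (y : L) + n * (y⁻¹ : Lˣ)),
    ← Finset.sum_fiberwise (Finset.univ.filter fun x : Fˣ => unitsNorm L F x = n)
      (fun x : Fˣ => Algebra.trace L F x), ← Finset.sum_add_distrib]
  have h : ∀ t : L, (∑ y ∈ Finset.univ.filter fun y : Lˣ => (y : L) + n * (y⁻¹ : Lˣ) = t,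
        traceChar p L (y + n * (y⁻¹ : Lˣ))) +
      ∑ x ∈ (Finset.univ.filter fun x : Fˣ => unitsNorm L F x = n).filter
        fun x : Fˣ => Algebra.trace L F x = t, traceChar p F x = 2 * traceChar p L t := by
    intro t
    rw [Finset.sum_congr rfl (g := fun _ => traceChar p L t)
        (fun y hy => by rw [(Finset.mem_filter.1 hy).2]),
      Finset.sum_congr rfl (s₁ := Finset.filter _ (Finset.filter _ _))
        (g := fun _ => traceChar p L t)
        (fun x hx => by rw [← (Finset.mem_filter.1 hx).2, traceChar_algebraMap_trace]),
      Finset.sum_const, Finset.sum_const, Finset.filter_filter, ← add_smul,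
      card_add_card_eq_two L F hLF n t, nsmul_eq_mul, Nat.cast_ofNat]
  rw [Finset.sum_congr rfl fun t _ => h t, ← Finset.mul_sum, sum_traceChar, mul_zero]

theorem sum_norm_fiber_pow (hLF : Module.finrank L F = 2) {d : ℕ}
    (hL : (Nat.card Lˣ).Coprime d) (hF : (Nat.card Fˣ).Coprime d) (n : Lˣ) :
    ∑ x : Fˣ with unitsNorm L F x = n, traceChar p F ((x : F) ^ d) = -kloosterman L p (n ^ d) := by
  rw [← sum_norm_fiber L F p hLF]
  refine Finset.sum_equiv (powCoprime hF) (fun x => ?_) (fun x _ => by simp)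
  simp only [Finset.mem_filter, Finset.mem_univ, true_and, powCoprime_apply, map_pow]
  exact (powCoprime hL).injective.eq_iff.symm

/-- The multiplicative convolution square of the Weil sums of `L` is the sum of the Weil sums of
its quadratic extension `F` over fibres of the norm. -/
theorem sum_weilSum_mul_eq_sum_norm_fiber (hLF : Module.finrank L F = 2) {d : ℕ}
    (hd : d ≠ 0) (hL : (Nat.card Lˣ).Coprime d) (hF : (Nat.card Fˣ).Coprime d) (b : Lˣ) :
    ∑ g : Lˣ, weilSum p L d g * weilSum p L d ((b * g⁻¹ : Lˣ) : L) =
      ∑ a : Fˣ with unitsNorm L F a = b, weilSum p F d a := by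
  set K := kloosterman L p with hK
  let U : Lˣ → ℂ := fun g => ∑ x : Lˣ, traceChar p L ((x : L) ^ d - g * x)
  have hU1 : ∑ g : Lˣ, U g = 1 := by
    simp only [U, sub_eq_add_neg, AddChar.map_add_eq_mul]
    rw [Finset.sum_comm]
    have h1 : ∀ x : Lˣ, ∑ g : Lˣ, traceChar p L (-((g : L) * x)) = -1 := by
      intro x
      rw [← sum_units_traceChar L p, ← Equiv.sum_comp (Equiv.mulRight (-x))
        fun g : Lˣ => traceChar p L g]
      simp
    have h2 : ∑ x : Lˣ, traceChar p L ((x : L) ^ d) = -1 := by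
      rw [← sum_units_traceChar L p, ← Equiv.sum_comp (powCoprime hL)
        fun g : Lˣ => traceChar p L g]
      simp
    simp_rw [← Finset.mul_sum, h1, ← Finset.sum_mul, h2]
    norm_num
  have hU2 : ∑ g : Lˣ, U (b * g⁻¹) = 1 := by
    rw [← hU1, ← Equiv.sum_comp ((Equiv.inv Lˣ).trans (Equiv.mulLeft b)) U]
    simp
  have hUU : ∑ g : Lˣ, U g * U (b * g⁻¹) = ∑ n : Lˣ, K (n ^ d) * K (b * n) := by
    simp only [U, Finset.sum_mul_sum, ← AddChar.map_add_eq_mul]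
    rw [Finset.sum_comm]
    have h1 : ∀ x y : Lˣ, ∑ g : Lˣ, traceChar p L (((x : L) ^ d - g * x) +
        ((y : L) ^ d - ((b * g⁻¹ : Lˣ) : L) * y)) =
        traceChar p L ((x : L) ^ d + (y : L) ^ d) * K (b * (x * y)) := by
      intro x y
      rw [hK, kloosterman, Finset.mul_sum, ← Equiv.sum_comp (Equiv.mulRight (-x))
        (fun h : Lˣ => traceChar p L ((x : L) ^ d + (y : L) ^ d) *
          traceChar p L (h + ((b * (x * y) : Lˣ) : L) * (h⁻¹ : Lˣ)))]
      refine Finset.sum_congr rfl fun g _ => ?_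
      rw [← AddChar.map_add_eq_mul]
      congr 1
      have hx : (x : L) ≠ 0 := x.ne_zero
      have hg : (g : L) ≠ 0 := g.ne_zero
      simp only [Equiv.coe_mulRight, Units.val_mul, Units.val_neg, Units.val_inv_eq_inv_val]
      field_simp
      ring
    calc _ = ∑ x : Lˣ, ∑ y : Lˣ, traceChar p L ((x : L) ^ d + (y : L) ^ d) * K (b * (x * y)) := by
          refine Finset.sum_congr rfl fun x _ => ?_
          rw [Finset.sum_comm]
          exact Finset.sum_congr rfl fun y _ => h1 x y
      _ = ∑ x : Lˣ, ∑ n : Lˣ,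
            traceChar p L ((x : L) ^ d + ((n * x⁻¹ : Lˣ) : L) ^ d) * K (b * n) := by
          refine Finset.sum_congr rfl fun x _ => ?_
          rw [← Equiv.sum_comp (Equiv.mulRight x⁻¹)]
          simp
      _ = _ := by
          rw [Finset.sum_comm]
          refine Finset.sum_congr rfl fun n _ => ?_
          rw [← Finset.sum_mul, hK, kloosterman_pow L p hL]
  have hUF : ∑ a : Fˣ with unitsNorm L F a = b,
      ∑ x : Fˣ, traceChar p F ((x : F) ^ d - (a : F) * x) = ∑ n : Lˣ, K (n ^ d) * K (b * n) := by
    have hneg : unitsNorm L F (-1) = 1 := by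
      ext
      have := Algebra.norm_algebraMap (S := F) (-1 : L)
      simpa [hLF] using this
    have h1 : ∀ x : Fˣ, ∑ a : Fˣ with unitsNorm L F a = b,
        traceChar p F ((x : F) ^ d - (a : F) * x) =
        traceChar p F ((x : F) ^ d) * -K (b * unitsNorm L F x) := by
      intro x
      rw [hK, ← sum_norm_fiber L F p hLF, Finset.mul_sum]
      refine Finset.sum_equiv (Equiv.mulRight (-x)) (fun a => ?_) (fun a _ => ?_)
      · simp only [Finset.mem_filter, Finset.mem_univ, true_and, Equiv.coe_mulRight]
        rw [← neg_one_mul x, map_mul, map_mul, hneg, one_mul, mul_left_inj]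
      · rw [← AddChar.map_add_eq_mul]
        simp [sub_eq_add_neg]
    rw [Finset.sum_comm, Finset.sum_congr rfl fun x _ => h1 x,
      ← Finset.sum_fiberwise Finset.univ (unitsNorm L F)]
    refine Finset.sum_congr rfl fun n _ => ?_
    rw [Finset.sum_congr rfl (g := fun x : Fˣ => traceChar p F ((x : F) ^ d) * -K (b * n))
      (fun x hx => by rw [(Finset.mem_filter.1 hx).2]), ← Finset.sum_mul,
      sum_norm_fiber_pow L F p hLF hL hF]
    ring
  have hcard : (Fintype.card Lˣ : ℂ) = Fintype.card L - 1 := by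
    rw [Fintype.card_units, Nat.cast_sub Fintype.card_pos, Nat.cast_one]
  simp only [weilSum_eq_units _ p hd]
  rw [Finset.sum_add_distrib, hUF, ← hUU, Finset.sum_const, card_unitsNorm_fiber L F hLF]
  change ∑ g : Lˣ, (1 + U g) * (1 + U (b * g⁻¹)) = _
  simp_rw [add_mul, mul_add, one_mul, mul_one, Finset.sum_add_distrib]
  rw [hU1, hU2, Finset.sum_const, Finset.card_univ]
  simp only [nsmul_eq_mul, hcard]
  push_cast
  ring

end QuadraticExtension

/-! ### Reduction modulo the prime above `p` and the tower -/

section Descent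

variable (p : ℕ) [Fact p.Prime]

/-- The least valuation of the multiplicative convolution square of a function on `Lˣ` is at most
twice the least valuation of the function: otherwise the function, divided by a value of least
valuation and reduced modulo the maximal ideal, would be a nonzero nilpotent element of a reduced
group algebra. -/
theorem exists_le_cycVal_convolution {L : Type*} [Field L] [Fintype L] [DecidableEq L]
    [Algebra (ZMod p) L] (w : Lˣ → CycField p) (g₀ : Lˣ) (hg₀ : w g₀ ≠ 0)
    (hmax : ∀ g, cycVal p (w g) ≤ cycVal p (w g₀)) :
    ∃ b, cycVal p (w g₀) ^ 2 ≤ cycVal p (∑ g, w g * w (b * g⁻¹)) := by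
  by_contra! hlt
  have hv : cycVal p (w g₀) ≠ 0 := (map_ne_zero _).2 hg₀
  let O := (cycVal p).valuationSubring
  have hmem : ∀ g, w g / w g₀ ∈ O := fun g => by
    rw [Valuation.mem_valuationSubring_iff, map_div₀]
    exact div_le_one_of_le₀ (hmax g) zero_le
  let u : Lˣ → O := fun g => ⟨w g / w g₀, hmem g⟩
  have hres : ∀ x : O, IsLocalRing.residue O x = 0 ↔ cycVal p x < 1 := fun x => by
    rw [IsLocalRing.residue_eq_zero_iff, Valuation.mem_maximalIdeal_iff]
  have : CharP (IsLocalRing.ResidueField O) p := by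
    refine ringChar.of_eq (CharP.ringChar_of_prime_eq_zero (Fact.out : p.Prime) ?_)
    rw [← map_natCast (IsLocalRing.residue O), hres]
    have := (cycVal_int_lt_one_iff p p).2 dvd_rfl
    exact_mod_cast this
  have hconv : ∀ b, ∑ g, IsLocalRing.residue O (u g) * IsLocalRing.residue O (u (b * g⁻¹)) = 0 := by
    intro b
    simp_rw [← map_mul]
    rw [← map_sum, hres]
    have h1 : ((∑ g, u g * u (b * g⁻¹) : O) : CycField p) =
        (∑ g, w g * w (b * g⁻¹)) / w g₀ ^ 2 := by
      push_cast
      rw [Finset.sum_div]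
      refine Finset.sum_congr rfl fun g _ => ?_
      simp only [u]
      rw [div_mul_div_comm, pow_two]
    rw [h1, map_div₀, map_pow, div_lt_one₀ (pow_pos (zero_lt_iff.2 hv) 2)]
    exact hlt b
  have hcard : Fintype.card L = p ^ Module.finrank (ZMod p) L := by
    rw [Module.card_eq_pow_finrank (K := ZMod p), ZMod.card]
  have h0 := eq_zero_of_convolution_eq_zero p (j := Module.finrank (ZMod p) L)
    (fun g : Lˣ => by ext; rw [← hcard]; simp [FiniteField.pow_card])
    Module.finrank_pos.ne' _ hconv g₀
  rw [hres] at h0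
  simp only [u, div_self hg₀, map_one, lt_self_iff_false] at h0

/-- Passing to a quadratic extension at most doubles `V`. -/
theorem minVal_le_two_mul {L F : Type*} [Field L] [Fintype L] [Field F] [Fintype F] [Algebra L F]
    [Algebra (ZMod p) L] [Algebra (ZMod p) F] [IsScalarTower (ZMod p) L F]
    (hLF : Module.finrank L F = 2) {d : ℕ} (hd : d ≠ 0) (hL : d.Coprime (Nat.card L - 1))
    (hF : d.Coprime (Nat.card F - 1)) {c : ℚ} (hc : minVal p L d ≤ (c : WithTop ℚ)) :
    minVal p F d ≤ ((2 * c : ℚ) : WithTop ℚ) := by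
  classical
  let W : L → CycField p := fun a => ⟨weilSum p L d a, weilSum_mem p L d a⟩
  let W' : F → CycField p := fun a => ⟨weilSum p F d a, weilSum_mem p F d a⟩
  obtain ⟨a₀, -, ha₀⟩ := Finset.exists_mem_eq_inf' Finset.univ_nonempty fun a : L => valP p (W a)
  have hmin : ∀ a, valP p (W a₀) ≤ valP p (W a) := fun a =>
    ha₀ ▸ Finset.inf'_le _ (Finset.mem_univ a)
  have hc' : valP p (W a₀) ≤ (c : WithTop ℚ) := ha₀ ▸ hc
  have hW0 : W a₀ ≠ 0 := by
    intro h
    rw [h, valP, if_pos rfl, top_le_iff] at hc'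
    exact WithTop.coe_ne_top hc'
  have ha0 : a₀ ≠ 0 := by
    rintro rfl
    refine hW0 (Subtype.ext ?_)
    change weilSum p L d 0 = 0
    rw [weilSum_eq, ← sum_traceChar p L]
    simp only [zero_mul, sub_zero]
    exact (pow_bijective L hd hL).sum_comp fun x => traceChar p L x
  have hv : cycVal p (W a₀) ≠ 0 := (map_ne_zero _).2 hW0
  have hmax : ∀ a, cycVal p (W a) ≤ cycVal p (W a₀) := by
    intro a
    have := hmin a
    rwa [valP_eq_div p hW0, le_valP_iff, neg_neg, exp_log hv] at this
  obtain ⟨b, hb⟩ := exists_le_cycVal_convolution p (fun g : Lˣ => W g) (Units.mk0 a₀ ha0) hW0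
    fun g => hmax g
  have hconv : ∑ g : Lˣ, W g * W ((b * g⁻¹ : Lˣ) : L) =
      ∑ a : Fˣ with unitsNorm L F a = b, W' a := by
    apply (algebraMap (CycField p) ℂ).injective
    rw [map_sum, map_sum]
    simp only [map_mul]
    refine sum_weilSum_mul_eq_sum_norm_fiber L F p hLF hd ?_ ?_ b
    · rw [Nat.card_units]; exact hL.symm
    · rw [Nat.card_units]; exact hF.symm
  rw [hconv] at hb
  obtain ⟨a, ha⟩ : ∃ a, cycVal p (W a₀) ^ 2 ≤ cycVal p (W' a) := by
    by_contra! hlt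
    exact hb.not_gt ((cycVal p).map_sum_lt (pow_ne_zero 2 hv) fun a _ => hlt a)
  refine (Finset.inf'_le (fun a : F => valP p (W' a)) (Finset.mem_univ a)).trans ?_
  rw [valP_eq_div p hW0, WithTop.coe_le_coe] at hc'
  refine le_trans (b := (((((-2 * log (cycVal p (W a₀)) : ℤ) : ℚ) / ((p : ℚ) - 1)) : ℚ) :
    WithTop ℚ)) ?_ ?_
  · rw [← not_lt, lt_valP_iff, not_lt]
    refine le_of_eq_of_le ?_ ha
    rw [← exp_log hv, ← exp_nsmul, log_exp]
    simp
  · rw [WithTop.coe_le_coe]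
    refine le_of_eq_of_le ?_ (mul_le_mul_of_nonneg_left hc' zero_le_two)
    push_cast
    ring

/-- In a field of degree `2 ^ s` over `𝔽_p`, climb the tower of quadratic extensions from the
first member over which `d` becomes nondegenerate. -/
theorem minVal_le_half_finrank (s : ℕ) : ∀ (F : Type*) [Field F] [Fintype F] [Algebra (ZMod p) F],
    Module.finrank (ZMod p) F = 2 ^ s → ∀ d : ℕ, d ≠ 0 → d.Coprime (Nat.card F - 1) →
    ¬ IsDegenerate p F d → IsDegenerate p (ZMod p) d →
    minVal p F d ≤ (((Module.finrank (ZMod p) F : ℚ) / 2 : ℚ) : WithTop ℚ) := by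
  induction s with
  | zero =>
    intro F _ _ _ hF d _ _ hnd hdeg
    have : Nat.card F = Nat.card (ZMod p) := by
      rw [Module.natCard_eq_pow_finrank (K := ZMod p), hF, pow_zero, pow_one]
    rw [IsDegenerate, this] at hnd
    exact absurd hdeg hnd
  | succ s ih =>
    intro F _ _ _ hF d hd hcop hnd hdeg
    classical
    obtain ⟨f⟩ := FiniteField.nonempty_algHom_of_finrank_dvd (F := ZMod p)
      (K := GaloisField p (2 ^ s)) (L := F) (by
        rw [GaloisField.finrank p (by positivity), hF]
        exact pow_dvd_pow 2 s.le_succ)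
    let L : IntermediateField (ZMod p) F := f.fieldRange
    have hLdeg : Module.finrank (ZMod p) L = 2 ^ s := by
      rw [← GaloisField.finrank p (n := 2 ^ s) (by positivity)]
      exact (AlgEquiv.ofInjectiveField f).toLinearEquiv.finrank_eq.symm
    have hLF : Module.finrank L F = 2 := by
      have := Module.finrank_mul_finrank (ZMod p) L F
      rw [hLdeg, hF, pow_succ] at this
      exact Nat.eq_of_mul_eq_mul_left (by positivity) this
    have hcard : Nat.card L ^ 2 = Nat.card F := by
      rw [Module.natCard_eq_pow_finrank (K := L) (V := F), hLF]
    by_cases hdL : IsDegenerate p L d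
    · exact (minVal_eq_of_isDegenerate_subfield p F (K := L.toSubfield) hcard hd hcop hnd hdL).le
    · have hcopL : d.Coprime (Nat.card L - 1) := by
        refine hcop.coprime_dvd_right ?_
        rw [← hcard]
        simpa using Nat.sub_dvd_pow_sub_pow (Nat.card L) 1 2
      have := minVal_le_two_mul p (F := F) hLF hd hcopL hcop (ih L hLdeg d hd hcopL hdL hdeg)
      refine this.trans_eq ?_
      rw [hLdeg, hF]
      congr 1
      push_cast
      ring

end Descent
end WeilSum

theorem theorem4p1 (p : ℕ) [Fact p.Prime] (F : Type*) [Field F] [Fintype F] [Algebra (ZMod p) F]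
    (s : ℕ) (hs : 1 ≤ s) (hF : Module.finrank (ZMod p) F = 2 ^ s)
    (d : ℕ) (hd : 0 < d) (hcop : Nat.Coprime d (Nat.card F - 1))
    (hnd : ¬ WeilSum.IsDegenerate p F d) (hdeg : WeilSum.IsDegenerate p (ZMod p) d) :
    WeilSum.minVal p F d ≤ (((Module.finrank (ZMod p) F : ℚ) / 2 : ℚ) : WithTop ℚ) ∧
      ∀ K : Subfield F, Nat.card K ^ 2 = Nat.card F → WeilSum.IsDegenerate p K d →
        WeilSum.minVal p F d = (((Module.finrank (ZMod p) F : ℚ) / 2 : ℚ) : WithTop ℚ) :=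
  ⟨WeilSum.minVal_le_half_finrank p s F hF d hd.ne' hcop hnd hdeg, fun _ hK hdK =>
    WeilSum.minVal_eq_of_isDegenerate_subfield p F hK hd.ne' hcop hnd hdK⟩
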